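/- For every odd integer $d\ge 1$ there is an integer $N=N(d)$ such that for every $n\ge N$ there is a smooth quartic hypersurface $H_d^n\subset\mathbb P^{n+1}$ over $K=\mathbb Q(t)$ such that $H_d^n$ has an $L$-point for some field extension $L/K$ of degree $d$, but $H_d^n(L)=\emptyset$ for every field extension $L/K$ whose degree is odd and smaller than $d$. Consequently the analogue of Springer's theorem fails for quartics: for all sufficiently large $n$ it is not true that every smooth quartic hypersurface in $\mathbb P^{n+1}$ over $\mathbb Q(t)$ that has a point over some extension of odd degree has a point over $\mathbb Q(t)$. (Here a quartic hypersurface is the zero locus of a nonzero form $F$ of degree $4$ over $K$, and it is smooth if $F$ and its first partial derivatives have no common zero in $\mathbb P^{n+1}(\overline K)$.) -/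

import Mathlib

open scoped LinearAlgebra.Projectivization

namespace ProjHypersurface

variable {K : Type*} [Field K] {m : ℕ}

/-- The `L`-valued points of the hypersurface `(F = 0)` in projective space with homogeneous
coordinates indexed by `Fin m`, where `F` is a form over `K` and `L` is an extension field of `K`.
For a form `F` the condition does not depend on the representative, see `mk_mem_points`. -/
def points (F : MvPolynomial (Fin m) K) (L : Type*) [Field L] [Algebra K L] :
    Set (ℙ L (Fin m → L)) :=
  {x | MvPolynomial.aeval x.rep F = 0}

theorem aeval_smul_of_isHomogeneous {F : MvPolynomial (Fin m) K} {e : ℕ}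
    (hF : F.IsHomogeneous e) {L : Type*} [Field L] [Algebra K L] (c : L) (v : Fin m → L) :
    MvPolynomial.aeval (c • v) F = c ^ e * MvPolynomial.aeval v F := by
  rw [MvPolynomial.aeval_def, MvPolynomial.aeval_def, MvPolynomial.eval₂_eq,
    MvPolynomial.eval₂_eq, Finset.mul_sum]
  refine Finset.sum_congr rfl fun s hs => ?_
  have h : ∑ i ∈ s.support, s i = e := by
    have := hF (MvPolynomial.mem_support_iff.mp hs)
    simpa [Finsupp.weight_apply, Finsupp.sum] using this
  simp only [Pi.smul_apply, smul_eq_mul, mul_pow, Finset.prod_mul_distrib,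
    Finset.prod_pow_eq_pow_sum]
  rw [h]
  ring

theorem mk_mem_points {F : MvPolynomial (Fin m) K} {e : ℕ} (hF : F.IsHomogeneous e)
    {L : Type*} [Field L] [Algebra K L] (v : Fin m → L) (hv : v ≠ 0) :
    Projectivization.mk L v hv ∈ points F L ↔ MvPolynomial.aeval v F = 0 := by
  obtain ⟨a, ha⟩ := Projectivization.exists_smul_eq_mk_rep L v hv
  change MvPolynomial.aeval (Projectivization.mk L v hv).rep F = 0 ↔ _
  rw [← ha, Units.smul_def, aeval_smul_of_isHomogeneous hF]
  simp

/-- `F` is a nonzero form of degree `e` over `K` whose hypersurface `(F = 0)` is smooth over `K`: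
at every geometric point of the hypersurface some partial derivative of `F` is nonzero. -/
structure IsSmoothForm (F : MvPolynomial (Fin m) K) (e : ℕ) : Prop where
  ne_zero : F ≠ 0
  isHomogeneous : F.IsHomogeneous e
  smooth : ∀ x ∈ points F (AlgebraicClosure K),
    ∃ i, MvPolynomial.aeval x.rep (MvPolynomial.pderiv i F) ≠ 0

/-- The Springer property over `K` for smooth hypersurfaces of degree `e` and dimension `n`, in
projective `(n + 1)`-space: a point over an extension of odd degree forces a `K`-point. -/
def SpringerProperty (K : Type) [Field K] (e n : ℕ) : Prop :=
  ∀ F : MvPolynomial (Fin (n + 2)) K, IsSmoothForm F e →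
    (∃ (L : Type) (_ : Field L) (_ : Algebra K L),
      Odd (Module.finrank K L) ∧ (points F L).Nonempty) →
    (points F K).Nonempty

end ProjHypersurface

/-! The quartic is a pencil member `P + t Q` over `ℚ(t)`. Over a real field `P` (`rootForm`)
vanishes only at points `x = z = (1 : a : ⋯ : a ^ d)`, `y = 0`, with `a ^ d = 2`. The form `Q` is `∑
x⁴ - ∑ z⁴ + ∑ y⁴`: it is smooth, and doubling the coordinates makes it vanish at those points too.
So adjoining a `d`-th root of `2` gives a point of degree `d`.

Smoothness is read off at `t = ∞`, where the pencil degenerates to `Q`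
(`exists_pderiv_pencil_ne_zero`). Small odd degrees are excluded at `t = 0`: a point over an odd
degree `L` specializes to a zero of `P` over a residue field `κ` of odd degree at most `[L : ℚ(t)]`
(`exists_residueField`). An odd degree number field embeds in `ℝ`, so `κ` contains a `d`-th root of
`2`, hence `d ∣ [κ : ℚ]` (`dvd_finrank_of_pow_eq_two`). -/

namespace ProjHypersurface

open MvPolynomial

/-! ### Pencils of integral forms -/

/-- The pencil member `P + t Q` over `ℚ(t)`, for integral polynomials `P` and `Q`. -/
noncomputable def pencil {σ : Type*} (P Q : MvPolynomial σ ℤ) : MvPolynomial σ (RatFunc ℚ) :=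
  map (Int.castRingHom _) P + C RatFunc.X * map (Int.castRingHom _) Q

theorem aeval_map_intCast {σ K L : Type*} [Field K] [Field L] [Algebra K L] (v : σ → L)
    (P : MvPolynomial σ ℤ) :
    aeval v (map (Int.castRingHom K) P) = aeval v P := by
  rw [aeval_def, aeval_def, eval₂_map]
  congr 1
  exact RingHom.ext_int _ _

theorem aeval_pencil {σ L : Type*} [Field L] [Algebra (RatFunc ℚ) L] (v : σ → L)
    (P Q : MvPolynomial σ ℤ) :
    aeval v (pencil P Q) = aeval v P + algebraMap (RatFunc ℚ) L RatFunc.X * aeval v Q := by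
  rw [pencil, map_add, map_mul, aeval_C, aeval_map_intCast, aeval_map_intCast]

theorem aeval_comp_ringHom {σ A B : Type*} [CommRing A] [CommRing B] (f : A →+* B) (v : σ → A)
    (P : MvPolynomial σ ℤ) : aeval (f ∘ v) P = f (aeval v P) := by
  rw [aeval_def, aeval_def, hom_eval₂]
  congr 1
  exact RingHom.ext_int _ _

theorem isHomogeneous_pencil {σ : Type*} {P Q : MvPolynomial σ ℤ} {e : ℕ}
    (hP : P.IsHomogeneous e) (hQ : Q.IsHomogeneous e) : (pencil P Q).IsHomogeneous e := by
  refine (hP.map _).add ?_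
  simpa using (isHomogeneous_C σ (RatFunc.X : RatFunc ℚ)).mul (hQ.map _)

theorem aeval_smul_int {m : ℕ} {P : MvPolynomial (Fin m) ℤ} {e : ℕ}
    (hP : P.IsHomogeneous e) {L : Type*} [Field L] (c : L) (v : Fin m → L) :
    aeval (c • v) P = c ^ e * aeval v P := by
  have := aeval_smul_of_isHomogeneous (hP.map (Int.castRingHom L)) c v
  rwa [aeval_map_intCast, aeval_map_intCast] at this

/-! ### The place `t = ∞` and smoothness -/

/-- Every valuation ring of a field is dominated by a valuation ring of a given extension. -/
theorem exists_valuationSubring_extension {K Γ : Type*} [Field K]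
    [LinearOrderedCommGroupWithZero Γ] (v : Valuation K Γ) (E : Type*) [Field E] [Algebra K E] :
    ∃ A : ValuationSubring E, (∀ x, v x < 1 → A.valuation (algebraMap K E x) < 1) ∧
      ∀ x, v x = 1 → A.valuation (algebraMap K E x) = 1 := by
  obtain ⟨A, h, hloc⟩ := IsLocalRing.exists_factor_valuationRing
    ((algebraMap K E).comp v.valuationSubring.subtype)
  have hle : ∀ x, v x ≤ 1 → A.valuation (algebraMap K E x) ≤ 1 := fun x hx =>
    (A.valuation_le_one_iff _).2 (h ⟨x, hx⟩)
  refine ⟨A, fun x hx => lt_of_le_of_ne (hle x hx.le) fun h1 => ?_, fun x hx => ?_⟩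
  · have hu := hloc.map_nonunit ⟨x, hx.le⟩ ((A.valuation_eq_one_iff ⟨_, h ⟨x, hx.le⟩⟩).2 h1)
    obtain ⟨y, hy⟩ := hu.exists_right_inv
    have hy' : v x * v y = 1 := by
      rw [← map_mul, ← map_one v]
      exact congrArg (fun z : v.valuationSubring => v z) hy
    exact absurd hy' (mul_lt_one_of_lt_of_le hx y.2).ne
  · refine le_antisymm (hle x hx.le) ?_
    have h1 := hle x⁻¹ (by simp [hx])
    rw [map_inv₀, map_inv₀] at h1
    by_contra! hlt
    have hx0 : x ≠ 0 := by
      rintro rfl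
      simp at hx
    have h0 : A.valuation (algebraMap K E x) ≠ 0 := by simpa using hx0
    exact absurd h1 (not_le.2 ((one_lt_inv₀ (zero_lt_iff.2 h0)).2 hlt))

/-- In some valuation ring of any field extension of `ℚ(t)`, the nonzero integers are units and
`1 / t` is a nonunit. -/
theorem exists_valuationSubring_over_infty (E : Type*) [Field E] [Algebra (RatFunc ℚ) E] :
    ∃ A : ValuationSubring E, A.valuation (algebraMap (RatFunc ℚ) E RatFunc.X)⁻¹ < 1 ∧
      ∀ c : ℤ, c ≠ 0 → A.valuation (c : E) = 1 := by
  classical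
  obtain ⟨A, h1, h2⟩ := exists_valuationSubring_extension (RatFunc.inftyValuation ℚ) E
  refine ⟨A, ?_, fun c hc => ?_⟩
  · rw [← map_inv₀]
    refine h1 _ ?_
    rw [← one_div, RatFunc.inftyValuation.X_inv]
    decide
  · have := h2 (c : RatFunc ℚ) (by
      have := RatFunc.inftyValuation.C ℚ (k := (c : ℚ)) (by exact_mod_cast hc)
      simpa using this)
    simpa using this

/-- A vector over a field with a valuation ring can be scaled to be integral with a coordinate
equal to one. -/
theorem exists_smul_integral {ι E : Type*} [Finite ι] [Field E] (A : ValuationSubring E)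
    {v : ι → E} (hv : v ≠ 0) : ∃ (w : ι → A) (i : ι), w i = 1 ∧
      v i ≠ 0 ∧ v = v i • (fun j => (w j : E)) := by
  obtain ⟨k, hk⟩ := Function.ne_iff.1 hv
  have : Nonempty ι := ⟨k⟩
  obtain ⟨i, hi⟩ := Finite.exists_max (fun j => A.valuation (v j))
  have hi0 : v i ≠ 0 := fun h0 => hk (by simpa [h0] using hi k)
  refine ⟨fun j => ⟨v j / v i, ?_⟩, i, ?_, hi0, ?_⟩
  · rw [← A.valuation_le_one_iff, map_div₀]
    exact div_le_one_of_le₀ (hi j) zero_le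
  · ext
    simp [hi0]
  · ext j
    simp [mul_div_cancel₀ _ hi0]

/-- The Fermat type form `∑ cₖ Xₖ ^ e`. -/
noncomputable def diagonal {m : ℕ} (c : Fin m → ℤ) (e : ℕ) : MvPolynomial (Fin m) ℤ :=
  ∑ k, C (c k) * X k ^ e

theorem isHomogeneous_diagonal {m : ℕ} (c : Fin m → ℤ) (e : ℕ) :
    (diagonal c e).IsHomogeneous e := by
  refine IsHomogeneous.sum _ _ _ fun k _ => ?_
  simpa using (isHomogeneous_C _ (c k)).mul ((isHomogeneous_X ℤ k).pow e)

theorem pderiv_diagonal {m : ℕ} (c : Fin m → ℤ) (e : ℕ) (i : Fin m) :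
    pderiv i (diagonal c e) = C (c i) * (C (e : ℤ) * X i ^ (e - 1)) := by
  rw [diagonal, map_sum, Finset.sum_eq_single i]
  · simp
  · intro k _ hk
    simp [pderiv_X_of_ne hk]
  · simp

theorem pderiv_pencil {σ : Type*} (P Q : MvPolynomial σ ℤ) (i : σ) :
    pderiv i (pencil P Q) = pencil (pderiv i P) (pderiv i Q) := by
  simp [pencil, pderiv_map]

/-- The generic member of a pencil containing a smooth diagonal form is smooth. -/
theorem exists_pderiv_pencil_ne_zero {m e : ℕ} {P : MvPolynomial (Fin m) ℤ}
    (hP : P.IsHomogeneous e) (he : e ≠ 0) {c : Fin m → ℤ} (hc : ∀ k, c k ≠ 0)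
    {E : Type*} [Field E] [Algebra (RatFunc ℚ) E] {v : Fin m → E} (hv : v ≠ 0) :
    ∃ i, aeval v (pderiv i (pencil P (diagonal c e))) ≠ 0 := by
  obtain ⟨A, hA, hAc⟩ := exists_valuationSubring_over_infty E
  obtain ⟨w, i, hwi, hvi, hvw⟩ := exists_smul_integral A hv
  refine ⟨i, fun h0 => ?_⟩
  set t := algebraMap (RatFunc ℚ) E RatFunc.X with ht
  have ht0 : t ≠ 0 := by simp [ht, RatFunc.X_ne_zero]
  rw [hvw, aeval_smul_of_isHomogeneous
    (isHomogeneous_pencil hP (isHomogeneous_diagonal c e)).pderiv, pderiv_pencil,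
    aeval_pencil, pderiv_diagonal, mul_eq_zero, or_iff_right (pow_ne_zero _ hvi)] at h0
  have h1 : aeval (fun j => (w j : E)) (pderiv i P) = ((aeval w (pderiv i P) : A) : E) :=
    aeval_comp_ringHom A.subtype w _
  rw [h1] at h0
  -- As `w i = 1`, the `i`-th partial of the diagonal form is the nonzero integer `c i * e`, a unit;
  -- the equation would put it in the maximal ideal.
  have h2 : ((c i * e : ℤ) : E) = -(t⁻¹ * ((aeval w (pderiv i P) : A) : E)) := by
    simp only [map_mul, map_pow, aeval_C, aeval_X, hwi] at h0
    field_simp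
    push_cast
    simp at h0
    linear_combination h0
  have h3 := hAc (c i * e) (mul_ne_zero (hc i) (by exact_mod_cast he))
  rw [h2, Valuation.map_neg, map_mul] at h3
  exact absurd h3 (mul_lt_one_of_lt_of_le hA (A.valuation_le_one _)).ne

theorem isSmoothForm_pencil {m e : ℕ} [NeZero m] {P : MvPolynomial (Fin m) ℤ}
    (hP : P.IsHomogeneous e) (he : e ≠ 0) {c : Fin m → ℤ} (hc : ∀ k, c k ≠ 0) :
    IsSmoothForm (pencil P (diagonal c e)) e where
  ne_zero h0 := by
    obtain ⟨i, hi⟩ := exists_pderiv_pencil_ne_zero hP he hc (E := RatFunc ℚ) one_ne_zero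
    simp [h0] at hi
  isHomogeneous := isHomogeneous_pencil hP (isHomogeneous_diagonal c e)
  smooth x _ := exists_pderiv_pencil_ne_zero hP he hc x.rep_nonzero

/-! ### The place `t = 0` and specialization of points -/

theorem exists_forall_dvd {R ι : Type*} [CommRing R] [IsDomain R] [ValuationRing R] [Finite ι]
    [Nonempty ι] (x : ι → R) : ∃ i, ∀ j, x i ∣ x j := by
  let r : ι → ι → Prop := fun a b => x b ∣ x a
  have : IsTrans ι r := ⟨fun _ _ _ h1 h2 => h2.trans h1⟩
  refine Directed.finite_le (r := r) (f := id) (fun i j => ?_) id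
  rcases ValuationRing.dvd_total (x i) (x j) with h | h
  · exact ⟨i, dvd_rfl, h⟩
  · exact ⟨j, h, dvd_rfl⟩

/-- A nonzero vector over a Dedekind domain is, up to scaling, nonzero modulo a given prime. -/
theorem exists_proportional_not_mem {B ι : Type*} [CommRing B] [IsDedekindDomain B] [Finite ι]
    (P : Ideal B) [P.IsPrime] (hP : P ≠ ⊥) {x : ι → B} (hx : x ≠ 0) :
    ∃ (i : ι) (s : B) (y : ι → B), x i ≠ 0 ∧ s ∉ P ∧ y i = s ∧ ∀ j, s * x j = x i * y j := by
  have : IsDiscreteValuationRing (Localization.AtPrime P) :=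
    IsLocalization.AtPrime.isDiscreteValuationRing_of_dedekind_domain B hP _
  have hinj : Function.Injective (algebraMap B (Localization.AtPrime P)) :=
    IsLocalization.injective _ P.primeCompl_le_nonZeroDivisors
  obtain ⟨k, hk⟩ := Function.ne_iff.1 hx
  have : Nonempty ι := ⟨k⟩
  -- Divide by a coordinate of least valuation at `P`; the quotients are `P`-integral and have a
  -- common denominator `s ∉ P`.
  obtain ⟨i, hi⟩ := exists_forall_dvd fun j => algebraMap B (Localization.AtPrime P) (x j)
  have hi0 : x i ≠ 0 := fun h0 => hk <| hinj <| by simpa [h0] using hi k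
  choose z hz using hi
  obtain ⟨s, hs⟩ := IsLocalization.exist_integer_multiples_of_finite P.primeCompl z
  choose y hy using hs
  have hxy : ∀ j, (s : B) * x j = x i * y j := fun j => hinj <| by
    rw [map_mul, map_mul, hz, hy, Algebra.smul_def]
    ring
  exact ⟨i, s, y, hi0, s.2, (mul_left_cancel₀ hi0 (by rw [← hxy, mul_comm])), hxy⟩

/-- A point of a pencil over the fraction field of a Dedekind domain specializes modulo a prime
containing the parameter. -/
theorem exists_specialization {B L : Type*} [CommRing B] [IsDedekindDomain B] [Field L]
    [Algebra B L] [IsFractionRing B L] (P : Ideal B) [P.IsPrime] (hP : P ≠ ⊥)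
    {m e : ℕ} {F G : MvPolynomial (Fin m) ℤ} (hF : F.IsHomogeneous e) (hG : G.IsHomogeneous e)
    {t : B} (ht : t ∈ P) {v : Fin m → L} (hv : v ≠ 0)
    (h : aeval v F + algebraMap B L t * aeval v G = 0) :
    ∃ w : Fin m → B ⧸ P, w ≠ 0 ∧ eval₂ (Int.castRingHom _) w F = 0 := by
  have hinj := IsFractionRing.injective B L
  obtain ⟨b, hb⟩ := IsLocalization.exist_integer_multiples_of_finite (nonZeroDivisors B) v
  choose x hx using hb
  have hb0 : algebraMap B L b ≠ 0 := IsFractionRing.to_map_ne_zero_of_mem_nonZeroDivisors b.2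
  have hxv : ∀ j, algebraMap B L (x j) = algebraMap B L b * v j := fun j => by
    rw [hx, Algebra.smul_def]
  have hx0 : x ≠ 0 := by
    rintro rfl
    refine hv (funext fun j => ?_)
    simpa [hb0] using hxv j
  obtain ⟨i, s, y, hxi, hs, hyi, hxy⟩ := exists_proportional_not_mem P hP hx0
  have hxi' : algebraMap B L (x i) ≠ 0 := by simpa using hinj.ne hxi
  have hy : algebraMap B L ∘ y =
      (algebraMap B L s * algebraMap B L b / algebraMap B L (x i)) • v := by
    ext j
    have := congrArg (algebraMap B L) (hxy j)
    rw [map_mul, map_mul, hxv] at this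
    simp only [Function.comp, Pi.smul_apply, smul_eq_mul]
    field_simp
    linear_combination -this
  have h1 : aeval y F + t * aeval y G = 0 := hinj <| by
    rw [map_add, map_mul, map_zero, ← aeval_comp_ringHom, ← aeval_comp_ringHom, hy,
      aeval_smul_int hF, aeval_smul_int hG]
    linear_combination
      (algebraMap B L s * algebraMap B L b / algebraMap B L (x i)) ^ e * h
  refine ⟨Ideal.Quotient.mk P ∘ y, fun h0 => hs ?_, ?_⟩
  · rw [← Ideal.Quotient.eq_zero_iff_mem, ← hyi]
    exact congrFun h0 i
  · have h2 : eval₂ ((Ideal.Quotient.mk P).comp (algebraMap ℤ B)) (Ideal.Quotient.mk P ∘ y) F =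
        Ideal.Quotient.mk P (eval₂ (algebraMap ℤ B) y F) := (hom_eval₂ _ _ _ _).symm
    rw [RingHom.ext_int (Int.castRingHom _) ((Ideal.Quotient.mk P).comp (algebraMap ℤ B)), h2,
      ← aeval_def, Ideal.Quotient.eq_zero_iff_mem, eq_neg_of_add_eq_zero_left h1]
    exact P.neg_mem (P.mul_mem_right _ ht)

/-- In an extension of odd degree some prime over a given prime has odd inertia degree. -/
theorem exists_odd_inertiaDeg {A K L B : Type*} [CommRing A] [IsDedekindDomain A] [CommRing B]
    [IsDedekindDomain B] [Field K] [Field L] [Algebra A B] [Algebra A K] [IsFractionRing A K]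
    [Algebra B L] [IsFractionRing B L] [Algebra K L] [Algebra A L] [IsScalarTower A B L]
    [IsScalarTower A K L] [Module.Finite A B] [Module.IsTorsionFree A B]
    (p : Ideal A) [p.IsMaximal] (hp : p ≠ ⊥) (hodd : Odd (Module.finrank K L)) :
    ∃ (P : Ideal B) (_ : P.LiesOver p), P.IsMaximal ∧ P ≠ ⊥ ∧
      Odd (Module.finrank (A ⧸ p) (B ⧸ P)) ∧
      Module.finrank (A ⧸ p) (B ⧸ P) ≤ Module.finrank K L := by
  -- Since `∑ e f` is odd, some product `e f` is odd, so its `f` is odd.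
  rw [← Ideal.sum_ramification_inertia B K L hp] at hodd
  obtain ⟨P, hPmem, hPodd⟩ : ∃ P ∈ IsDedekindDomain.primesOverFinset p B,
      Odd (p.ramificationIdx' P * p.inertiaDeg' P) := by
    by_contra! h
    exact absurd hodd (Nat.not_odd_iff_even.2 (Finset.even_sum _ fun P hP => by simpa using h P hP))
  obtain ⟨hPp, hPo⟩ := (IsDedekindDomain.mem_primesOverFinset_iff hp B).1 hPmem
  have hle : p.inertiaDeg' P ≤ Module.finrank K L := by
    rw [← Ideal.sum_ramification_inertia B K L hp]
    exact (Nat.le_mul_of_pos_left _ (Nat.odd_mul.1 hPodd).1.pos).trans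
      (Finset.single_le_sum (f := fun P => p.ramificationIdx' P * p.inertiaDeg' P)
        (fun _ _ => Nat.zero_le _) hPmem)
  have hfodd := (Nat.odd_mul.1 hPodd).2
  rw [Ideal.inertiaDeg'_algebraMap] at hle hfodd
  exact ⟨P, hPo, Ideal.IsMaximal.of_liesOver_isMaximal P p,
    Ideal.ne_bot_of_liesOver_of_ne_bot hp P, hfodd, hle⟩

/-- An odd degree extension of `ℚ(t)` has a residue field of odd degree at the place `t = 0`, to
which points of pencils specialize. -/
theorem exists_residueField (L : Type) [Field L] [Algebra (RatFunc ℚ) L]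
    (hodd : Odd (Module.finrank (RatFunc ℚ) L)) :
    ∃ (κ : Type) (_ : Field κ) (_ : NumberField κ), Odd (Module.finrank ℚ κ) ∧
      Module.finrank ℚ κ ≤ Module.finrank (RatFunc ℚ) L ∧
      ∀ (m e : ℕ) (F G : MvPolynomial (Fin m) ℤ) (_ : F.IsHomogeneous e) (_ : G.IsHomogeneous e)
        (v : Fin m → L), v ≠ 0 → aeval v (pencil F G) = 0 →
        ∃ w : Fin m → κ, w ≠ 0 ∧ aeval w F = 0 := by
  -- `finrank` is `0` for infinite extensions, so oddness already gives finiteness.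
  have hfin : FiniteDimensional (RatFunc ℚ) L := Module.finite_of_finrank_pos hodd.pos
  let : Algebra (Polynomial ℚ) L :=
    ((algebraMap (RatFunc ℚ) L).comp (algebraMap (Polynomial ℚ) (RatFunc ℚ))).toAlgebra
  have : IsScalarTower (Polynomial ℚ) (RatFunc ℚ) L := IsScalarTower.of_algebraMap_eq fun _ => rfl
  have : Module.IsTorsionFree (Polynomial ℚ) L :=
    Module.IsTorsionFree.trans_faithfulSMul (Polynomial ℚ) (RatFunc ℚ) L
  have : IsDedekindDomain (integralClosure (Polynomial ℚ) L) :=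
    integralClosure.isDedekindDomain (Polynomial ℚ) (RatFunc ℚ) L
  have : IsFractionRing (integralClosure (Polynomial ℚ) L) L :=
    integralClosure.isFractionRing_of_finite_extension (RatFunc ℚ) L
  have : Module.Finite (Polynomial ℚ) (integralClosure (Polynomial ℚ) L) :=
    IsIntegralClosure.finite (Polynomial ℚ) (RatFunc ℚ) L _
  have hmax : (Ideal.span {(Polynomial.X : Polynomial ℚ)}).IsMaximal :=
    PrincipalIdealRing.isMaximal_of_irreducible Polynomial.irreducible_X
  obtain ⟨P, hPo, hPm, hP0, hfodd, hle⟩ := exists_odd_inertiaDeg (K := RatFunc ℚ) (L := L)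
    (B := integralClosure (Polynomial ℚ) L) (Ideal.span {(Polynomial.X : Polynomial ℚ)})
    (by rw [Ne, Ideal.span_singleton_eq_bot]; exact Polynomial.X_ne_zero) hodd
  let : Field (integralClosure (Polynomial ℚ) L ⧸ P) := Ideal.Quotient.field P
  have : CharZero (integralClosure (Polynomial ℚ) L ⧸ P) := charZero_of_injective_ringHom
    (((Ideal.Quotient.mk P).comp (algebraMap (Polynomial ℚ) _)).comp Polynomial.C).injective
  let ε : (Polynomial ℚ ⧸ Ideal.span {(Polynomial.X : Polynomial ℚ)}) ≃+* ℚ :=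
    (Ideal.quotEquivOfEq (by simp)).trans
      (Polynomial.quotientSpanXSubCAlgEquiv (0 : ℚ)).toRingEquiv
  rw [Algebra.finrank_eq_of_equiv_equiv ε (RingEquiv.refl _) (RingHom.ext fun x => by
    exact (RingHom.congr_fun (Subsingleton.elim (algebraMap ℚ _)
      ((algebraMap _ (integralClosure (Polynomial ℚ) L ⧸ P)).comp ε.symm.toRingHom)) (ε x)).trans
        (congrArg (algebraMap _ (integralClosure (Polynomial ℚ) L ⧸ P))
          (ε.symm_apply_apply x)))] at hfodd hle
  have := Module.finite_of_finrank_pos hfodd.pos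
  refine ⟨_, inferInstance, NumberField.mk, hfodd, hle,
    fun m e F G hF hG v hv hv0 => ?_⟩
  rw [aeval_pencil] at hv0
  have hX : algebraMap (Polynomial ℚ) (integralClosure (Polynomial ℚ) L) Polynomial.X ∈ P :=
    (Ideal.mem_of_liesOver P (Ideal.span {(Polynomial.X : Polynomial ℚ)}) _).1
      (Ideal.mem_span_singleton_self _)
  have h0 : aeval v F + algebraMap (integralClosure (Polynomial ℚ) L) L
      (algebraMap (Polynomial ℚ) _ Polynomial.X) * aeval v G = 0 := by
    rw [← IsScalarTower.algebraMap_apply, IsScalarTower.algebraMap_apply _ (RatFunc ℚ) L,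
      RatFunc.algebraMap_X]
    exact hv0
  obtain ⟨w, hw, hw0⟩ := exists_specialization P hP0 hF hG hX hv h0
  refine ⟨w, hw, ?_⟩
  rw [aeval_def]
  exact (congrArg (fun f => eval₂ f w F) (RingHom.ext_int _ _)).trans hw0

/-! ### Real embeddings and roots of two -/

/-- The degree is `r₁ + 2 r₂`, so `r₁` is odd and in particular positive. -/
theorem _root_.NumberField.exists_ringHom_real_of_odd (κ : Type*) [Field κ] [NumberField κ]
    (h : Odd (Module.finrank ℚ κ)) : Nonempty (κ →+* ℝ) := by
  classical
  rw [← NumberField.InfinitePlace.card_add_two_mul_card_eq_rank, Nat.odd_add] at h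
  have h1 : Odd (NumberField.InfinitePlace.nrRealPlaces κ) := h.2 (even_two_mul _)
  obtain ⟨w⟩ := Fintype.card_pos_iff.1 h1.pos
  exact ⟨NumberField.InfinitePlace.embedding_of_isReal w.2⟩

/-- An extension of `ℚ` containing a `d`-th root of `2` has degree divisible by `d`. -/
theorem dvd_finrank_of_pow_eq_two {κ : Type*} [Field κ] [Algebra ℚ κ] {d : ℕ} {a : κ}
    (ha : a ^ d = 2) : d ∣ Module.finrank ℚ κ := by
  -- Comparing 2-adic valuations of the norms gives `d * v₂(N a) = [κ : ℚ]`.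
  have h1 : Algebra.norm ℚ a ^ d = 2 ^ Module.finrank ℚ κ := by
    rw [← map_pow, ha, ← map_ofNat (algebraMap ℚ κ) 2, Algebra.norm_algebraMap]
  have h2 := congrArg (padicValRat 2) h1
  have : Fact (Nat.Prime 2) := ⟨Nat.prime_two⟩
  have h3 : padicValRat 2 2 = 1 := padicValRat.self (p := 2) one_lt_two
  rw [padicValRat.pow, padicValRat.pow, h3, mul_one] at h2
  exact_mod_cast Dvd.intro _ h2

/-- Eisenstein at `2` over `ℤ` and Gauss's lemma give irreducibility over `ℚ`; monicity lifts it
along `t ↦ 0` to `ℚ[t]`, and Gauss's lemma again reaches `ℚ(t)`. -/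
theorem irreducible_X_pow_sub_two {d : ℕ} (hd : 0 < d) :
    Irreducible (Polynomial.X ^ d - Polynomial.C 2 : Polynomial (RatFunc ℚ)) := by
  have hZ : Irreducible (Polynomial.X ^ d - Polynomial.C 2 : Polynomial ℤ) := by
    have hp : Prime (2 : ℤ) := Int.prime_two
    refine Polynomial.irreducible_of_eisenstein_criterion (P := Ideal.span {2})
      ((Ideal.span_singleton_prime two_ne_zero).2 hp) ?_ ?_ ?_ ?_
      (Polynomial.monic_X_pow_sub_C _ hd.ne').isPrimitive
    · rw [(Polynomial.monic_X_pow_sub_C _ hd.ne').leadingCoeff, Ideal.mem_span_singleton]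
      norm_num
    · intro n hn
      rw [Polynomial.degree_X_pow_sub_C hd, Nat.cast_lt] at hn
      rw [Polynomial.coeff_sub, Polynomial.coeff_X_pow, if_neg hn.ne, Polynomial.coeff_C,
        Ideal.mem_span_singleton]
      split_ifs <;> norm_num
    · rw [Polynomial.degree_X_pow_sub_C hd]
      exact_mod_cast hd
    · rw [Polynomial.coeff_sub, Polynomial.coeff_X_pow, if_neg hd.ne, Polynomial.coeff_C_zero,
        Ideal.span_singleton_pow, Ideal.mem_span_singleton]
      norm_num
  rw [(Polynomial.monic_X_pow_sub_C _ hd.ne').irreducible_iff_irreducible_map_fraction_map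
    (K := ℚ)] at hZ
  have hA : Irreducible (Polynomial.X ^ d - Polynomial.C 2 : Polynomial (Polynomial ℚ)) := by
    refine (Polynomial.monic_X_pow_sub_C _ hd.ne').irreducible_of_irreducible_map
      (Polynomial.evalRingHom 0) _ ?_
    simpa [Polynomial.C_ofNat] using hZ
  rw [(Polynomial.monic_X_pow_sub_C _ hd.ne').irreducible_iff_irreducible_map_fraction_map
    (K := RatFunc ℚ)] at hA
  rwa [Polynomial.map_sub, Polynomial.map_pow, Polynomial.map_X, Polynomial.map_C,
    map_ofNat] at hA

/-- An extension of `ℚ(t)` of degree `d` containing a `d`-th root of `2`. -/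
theorem exists_extension_root {d : ℕ} (hd : 0 < d) :
    ∃ (L : Type) (_ : Field L) (_ : Algebra (RatFunc ℚ) L),
      Module.finrank (RatFunc ℚ) L = d ∧ ∃ a : L, a ^ d = 2 := by
  have : Fact (Irreducible (Polynomial.X ^ d - Polynomial.C 2 : Polynomial (RatFunc ℚ))) :=
    ⟨irreducible_X_pow_sub_two hd⟩
  refine ⟨AdjoinRoot (Polynomial.X ^ d - Polynomial.C 2 : Polynomial (RatFunc ℚ)),
    inferInstance, inferInstance, ?_, AdjoinRoot.root _, ?_⟩
  · rw [(AdjoinRoot.powerBasis this.out.ne_zero).finrank, AdjoinRoot.powerBasis_dim,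
      Polynomial.natDegree_X_pow_sub_C]
  · have := AdjoinRoot.eval₂_root
      (Polynomial.X ^ d - Polynomial.C 2 : Polynomial (RatFunc ℚ))
    rw [Polynomial.eval₂_sub, Polynomial.eval₂_X_pow, Polynomial.eval₂_C, sub_eq_zero] at this
    exact this.trans (map_ofNat _ 2)

/-! ### The quartic form and its zeros -/

section Form

variable {d r m : ℕ}

/-- A sum of squares of quadrics cutting out the points `(1 : a : ⋯ : a ^ d)` with `a ^ d = 2`,
embedded diagonally in a product of two copies of the coordinates. -/
noncomputable def rootForm (e : Fin (d + 1) ⊕ Fin (d + 1) ⊕ Fin r ≃ Fin m) :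
    MvPolynomial (Fin m) ℤ :=
  let x : Fin (d + 1) → MvPolynomial (Fin m) ℤ := fun i => X (e (.inl i))
  let z : Fin (d + 1) → MvPolynomial (Fin m) ℤ := fun i => X (e (.inr (.inl i)))
  let y : Fin r → MvPolynomial (Fin m) ℤ := fun i => X (e (.inr (.inr i)))
  ∑ i : Fin d, ∑ j : Fin d, (x i.castSucc * x j.succ - x i.succ * x j.castSucc) ^ 2 +
    (x (Fin.last d) - 2 * x 0) ^ 4 + ∑ i, (z i - x i) ^ 4 + ∑ i, y i ^ 4

/-- The coefficients of a smooth diagonal form vanishing on the diagonal `x = z`, `y = 0`. -/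
def diagonalCoeff (e : Fin (d + 1) ⊕ Fin (d + 1) ⊕ Fin r ≃ Fin m) (k : Fin m) : ℤ :=
  Sum.elim (fun _ => 1) (Sum.elim (fun _ => -1) fun _ => 1) (e.symm k)

variable (e : Fin (d + 1) ⊕ Fin (d + 1) ⊕ Fin r ≃ Fin m)

theorem diagonalCoeff_ne_zero (k : Fin m) : diagonalCoeff e k ≠ 0 := by
  unfold diagonalCoeff
  rcases e.symm k with i | i | i <;> simp

theorem isHomogeneous_rootForm : (rootForm e).IsHomogeneous 4 := by
  have hX : ∀ i : Fin m, (X i : MvPolynomial (Fin m) ℤ).IsHomogeneous 1 := isHomogeneous_X ℤ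
  have h2 : (2 : MvPolynomial (Fin m) ℤ).IsHomogeneous 0 := by
    simpa using isHomogeneous_C (Fin m) (2 : ℤ)
  refine (((IsHomogeneous.sum _ _ _ fun i _ => IsHomogeneous.sum _ _ _ fun j _ => ?_).add ?_).add
    (IsHomogeneous.sum _ _ _ fun i _ => ?_)).add (IsHomogeneous.sum _ _ _ fun i _ => ?_)
  · exact (((hX _).mul (hX _)).sub ((hX _).mul (hX _))).pow 2
  · exact ((hX _).sub (by simpa using h2.mul (hX _))).pow 4
  · exact ((hX _).sub (hX _)).pow 4
  · exact (hX _).pow 4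

theorem aeval_rootForm {L : Type*} [Field L] (v : Fin m → L) :
    aeval v (rootForm e) = ∑ i : Fin d, ∑ j : Fin d,
      (v (e (.inl i.castSucc)) * v (e (.inl j.succ)) -
        v (e (.inl i.succ)) * v (e (.inl j.castSucc))) ^ 2 +
      (v (e (.inl (Fin.last d))) - 2 * v (e (.inl 0))) ^ 4 +
      ∑ i, (v (e (.inr (.inl i))) - v (e (.inl i))) ^ 4 + ∑ i, v (e (.inr (.inr i))) ^ 4 := by
  simp [rootForm]

theorem aeval_diagonal {L : Type*} [Field L] (v : Fin m → L) :
    aeval v (diagonal (diagonalCoeff e) 4) =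
      ∑ i, v (e (.inl i)) ^ 4 + (-∑ i, v (e (.inr (.inl i))) ^ 4 +
        ∑ i, v (e (.inr (.inr i))) ^ 4) := by
  simp [diagonal, diagonalCoeff, ← e.sum_comp]

/-- The point `x = z = (1, a, …, a ^ d)`, `y = 0`. -/
theorem exists_common_zero {L : Type*} [Field L] {a : L} (ha : a ^ d = 2) :
    ∃ v : Fin m → L, v ≠ 0 ∧ aeval v (rootForm e) = 0 ∧
      aeval v (diagonal (diagonalCoeff e) 4) = 0 := by
  refine ⟨fun k => Sum.elim (fun i : Fin (d + 1) => a ^ (i : ℕ))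
    (Sum.elim (fun i : Fin (d + 1) => a ^ (i : ℕ)) fun _ => 0)
    (e.symm k), fun h => ?_, ?_, ?_⟩
  · simpa using congrFun h (e (.inl 0))
  · rw [aeval_rootForm]
    simp [ha]
    exact Finset.sum_eq_zero fun i _ => Finset.sum_eq_zero fun j _ => by ring
  · rw [aeval_diagonal]
    simp

/-- A point where the `2 × 2` minors vanish, with `x_d = 2 x_0`, comes from a `d`-th root
of two. -/
theorem exists_root_of_minors {κ : Type*} [Field κ] (hd : 0 < d) {x : Fin (d + 1) → κ}
    (hx : x ≠ 0) (h : ∀ i j : Fin d, x i.castSucc * x j.succ = x i.succ * x j.castSucc)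
    (hlast : x (Fin.last d) = 2 * x 0) : ∃ a : κ, a ^ d = 2 := by
  obtain ⟨d, rfl⟩ := Nat.exists_eq_succ_of_ne_zero hd.ne'
  by_cases h0 : x 0 = 0
  · refine absurd (funext fun i => ?_) hx
    -- The minor `x_i x_{i+2} = x_{i+1}²` propagates vanishing; the last coordinate is `2 x_0`.
    have key : ∀ i : ℕ, ∀ hi : i < d + 2, x ⟨i, hi⟩ = 0 := by
      intro i
      induction i with
      | zero => exact fun _ => h0
      | succ i ih =>
        intro hi
        by_cases hi' : i + 1 = d + 1
        · have : (⟨i + 1, hi⟩ : Fin (d + 2)) = Fin.last (d + 1) := Fin.ext hi'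
          rw [this, hlast, h0, mul_zero]
        · have := h ⟨i, by omega⟩ ⟨i + 1, by omega⟩
          simp only [Fin.castSucc_mk, Fin.succ_mk, ih (by omega), zero_mul] at this
          simpa using this.symm
    exact key i i.2
  · refine ⟨x 1 / x 0, ?_⟩
    -- The minors `x_0 x_{i+1} = x_1 x_i` force a geometric progression.
    have key : ∀ i : Fin (d + 2), x i = (x 1 / x 0) ^ (i : ℕ) * x 0 := by
      intro i
      induction i using Fin.induction with
      | zero => simp
      | succ i ih =>
        have := h 0 i
        rw [Fin.castSucc_zero, ih, Fin.succ_zero_eq_one] at this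
        rw [Fin.val_succ, pow_succ]
        refine mul_left_cancel₀ h0 (this.trans ?_)
        rw [Fin.val_castSucc]
        field_simp
    have := key (Fin.last _)
    rw [hlast] at this
    exact (mul_right_cancel₀ h0 this).symm

/-- A zero of `rootForm` over a real field gives a `d`-th root of two. -/
theorem exists_root_of_aeval_rootForm {κ : Type*} [Field κ] (f : κ →+* ℝ) (hd : 0 < d)
    {v : Fin m → κ} (hv : v ≠ 0) (h : aeval v (rootForm e) = 0) : ∃ a : κ, a ^ d = 2 := by
  have h1 := congrArg f h
  rw [← aeval_comp_ringHom, aeval_rootForm, map_zero] at h1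
  have hA : 0 ≤ ∑ i : Fin d, ∑ j : Fin d,
      ((f ∘ v) (e (.inl i.castSucc)) * (f ∘ v) (e (.inl j.succ)) -
        (f ∘ v) (e (.inl i.succ)) * (f ∘ v) (e (.inl j.castSucc))) ^ 2 :=
    Finset.sum_nonneg fun i _ => Finset.sum_nonneg fun j _ => sq_nonneg _
  have hB : 0 ≤ ((f ∘ v) (e (.inl (Fin.last d))) - 2 * (f ∘ v) (e (.inl 0))) ^ 4 := by positivity
  have hC : 0 ≤ ∑ i, ((f ∘ v) (e (.inr (.inl i))) - (f ∘ v) (e (.inl i))) ^ 4 :=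
    Finset.sum_nonneg fun i _ => by positivity
  have hD : 0 ≤ ∑ i, (f ∘ v) (e (.inr (.inr i))) ^ 4 :=
    Finset.sum_nonneg fun i _ => by positivity
  -- In `ℝ` a vanishing sum of even powers vanishes term by term.
  rw [add_eq_zero_iff_of_nonneg (by positivity) hD, add_eq_zero_iff_of_nonneg (by positivity) hC,
    add_eq_zero_iff_of_nonneg hA hB] at h1
  obtain ⟨⟨⟨h1, h2⟩, h3⟩, h4⟩ := h1
  have h2 := pow_eq_zero_iff (four_ne_zero) |>.1 h2
  have h3 := fun i => (Finset.sum_eq_zero_iff_of_nonneg fun i _ => by positivity).1 h3 i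
    (Finset.mem_univ _)
  have h4 := fun i => (Finset.sum_eq_zero_iff_of_nonneg fun i _ => by positivity).1 h4 i
    (Finset.mem_univ _)
  have h1 := fun i j => (Finset.sum_eq_zero_iff_of_nonneg fun j _ => sq_nonneg _).1
    ((Finset.sum_eq_zero_iff_of_nonneg fun i _ => Finset.sum_nonneg fun j _ => sq_nonneg _).1 h1 i
    (Finset.mem_univ _)) j (Finset.mem_univ _)
  refine exists_root_of_minors hd (x := fun i => v (e (.inl i))) (fun hx => hv ?_) ?_ ?_
  · have hx' : ∀ i, v (e (.inl i)) = 0 := fun i => congrFun hx i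
    ext k
    obtain ⟨k, rfl⟩ := e.surjective k
    rcases k with i | i | i
    · exact hx' i
    · simpa [hx'] using h3 i
    · simpa using h4 i
  · intro i j
    refine f.injective ?_
    simpa [sub_eq_zero] using h1 i j
  · refine f.injective ?_
    rw [map_mul, map_ofNat]
    exact sub_eq_zero.1 h2

end Form

end ProjHypersurface

/-! ### The main theorem -/

open MvPolynomial ProjHypersurface in
theorem ProjHypersurface.exists_smooth_quartic (d : ℕ) (hd : Odd d) (n : ℕ) (hn : 2 * d ≤ n) :
    ∃ F : MvPolynomial (Fin (n + 2)) (RatFunc ℚ), IsSmoothForm F 4 ∧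
      (∃ (L : Type) (_ : Field L) (_ : Algebra (RatFunc ℚ) L),
        Module.finrank (RatFunc ℚ) L = d ∧ (points F L).Nonempty) ∧
      ∀ (L : Type) (_ : Field L) (_ : Algebra (RatFunc ℚ) L),
        Odd (Module.finrank (RatFunc ℚ) L) → Module.finrank (RatFunc ℚ) L < d →
          points F L = ∅ := by
  obtain ⟨r, rfl⟩ := Nat.exists_eq_add_of_le hn
  -- Two blocks of `d + 1` coordinates account for `2 * d ≤ n`; the other `r` are padding.
  let e : Fin (d + 1) ⊕ Fin (d + 1) ⊕ Fin r ≃ Fin (2 * d + r + 2) :=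
    Fintype.equivOfCardEq (by simp; ring)
  have hG := isHomogeneous_diagonal (diagonalCoeff e) 4
  have hF := isHomogeneous_rootForm e
  refine ⟨pencil (rootForm e) (diagonal (diagonalCoeff e) 4),
    isSmoothForm_pencil hF four_ne_zero (diagonalCoeff_ne_zero e), ?_, ?_⟩
  · obtain ⟨L, _, _, hL, a, ha⟩ := exists_extension_root hd.pos
    obtain ⟨v, hv, h1, h2⟩ := exists_common_zero e ha
    refine ⟨L, _, _, hL, Projectivization.mk L v hv, ?_⟩
    rw [mk_mem_points (isHomogeneous_pencil hF hG), aeval_pencil, h1, h2, mul_zero, add_zero]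
  · intro L _ _ hodd hlt
    refine Set.eq_empty_of_forall_notMem fun x hx => ?_
    obtain ⟨κ, _, _, hκ, hle, hsp⟩ := exists_residueField L hodd
    obtain ⟨w, hw, hw0⟩ := hsp _ _ _ _ hF hG _ x.rep_nonzero hx
    obtain ⟨f⟩ := NumberField.exists_ringHom_real_of_odd κ hκ
    obtain ⟨a, ha⟩ := exists_root_of_aeval_rootForm e f hd.pos hw hw0
    exact absurd (Nat.le_of_dvd hκ.pos (dvd_finrank_of_pow_eq_two ha)) (by omega)

theorem mainTheorem7 :
    (∀ d : ℕ, Odd d → ∃ N : ℕ, ∀ n : ℕ, N ≤ n →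
      ∃ F : MvPolynomial (Fin (n + 2)) (RatFunc ℚ),
        ProjHypersurface.IsSmoothForm F 4 ∧
        (∃ (L : Type) (_ : Field L) (_ : Algebra (RatFunc ℚ) L),
          Module.finrank (RatFunc ℚ) L = d ∧ (ProjHypersurface.points F L).Nonempty) ∧
        (∀ (L : Type) (_ : Field L) (_ : Algebra (RatFunc ℚ) L),
          Odd (Module.finrank (RatFunc ℚ) L) → Module.finrank (RatFunc ℚ) L < d →
            ProjHypersurface.points F L = ∅)) ∧
    (∃ N : ℕ, ∀ n : ℕ, N ≤ n → ¬ ProjHypersurface.SpringerProperty (RatFunc ℚ) 4 n) := by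
  -- For the failure of Springer take `d = 3`, so `N = 2 * 3`; the base field has degree `1 < 3`.
  refine ⟨fun d hd => ⟨2 * d, ProjHypersurface.exists_smooth_quartic d hd⟩, 6, fun n hn h => ?_⟩
  obtain ⟨F, hF, ⟨L, _, _, hL, hne⟩, hempty⟩ :=
    ProjHypersurface.exists_smooth_quartic 3 (by decide) n hn
  have h1 := h F hF ⟨L, _, _, by rw [hL]; decide, hne⟩
  rw [hempty (RatFunc ℚ) _ _ (by simp) (by simp)] at h1
  exact Set.not_nonempty_empty h1
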